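/- **Theorem 1 (fused penalty with known transferable structure).** Let $K\ge 1$. For $k=0,\dots,K$ let $y^{(k)}=X^{(k)}(\beta^*+\delta^{*(k)})+\varepsilon^{(k)}$ with $\delta^{*(0)}=0$, where $X^{(k)}$ is a random $n_k\times p$ matrix, $n_0=n_T$ (target), $n_k=n_S$ for $k\ge1$ (sources), and $N=Kn_S+n_T$. Assume: * all rows $X^{(k)}_{i\cdot}$ are independent, with mean zero and covariance $\Sigma^{(k)}$ whose eigenvalues lie in $[1/c,c]$, and are sub-Gaussian with constant $\tau$, that is, $\mathbb E\exp(t\langle v,X^{(k)}_{i\cdot}\rangle)\le\exp(\tau\|v\|_2^2t^2/2)$ for all $v\in\mathbb R^p$, $t\in\mathbb R$; * all noise entries $\varepsilon^{(k)}_i$ are independent centred Gaussian with variance $\sigma_k\le c$, and the noise is independent of the features. Put $S_0=\{j:\beta^*_j\ne0\}$ and $S_k=\{j:\delta^{*(k)}_j\neq0\}$ for $k\ge1$, and choose the weights $w^{(k)}_j=\mathbf 1\{j\in S_k^c\}$, $0\le k\le K$. Consider the weighted fused-penalty problem $$\min_{\beta,\delta^{(1)},\dots,\delta^{(K)}}\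 \frac1N\sum_{k=0}^K\|y^{(k)}-X^{(k)}(\beta+\delta^{(k)})\|_2^2+\lambda_0\sum_{j=1}^pw^{(0)}_j|\beta_j|+\lambda_1\sum_{k=1}^K\sum_{j=1}^pw^{(k)}_j|\delta^{(k)}_j|\qquad(\delta^{(0)}=0)$$ and the oracle constrained least-squares problem $$\min_{\beta,\delta^{(1)},\dots,\delta^{(K)}}\ \frac1N\sum_{k=0}^K\|y^{(k)}-X^{(k)}(\beta+\delta^{(k)})\|_2^2\quad\text{subject to}\quad\beta_{S_0^c}=0,\ \ \delta^{(k)}_{S_k^c}=0\ (1\le k\le K).$$ For all constants $c,\tau,c_S>0$ and $a\ge0$ there are constants $C,c_1>0$, depending only on $c,\tau,c_S,a$, such that the following holds. If $n_S\ge c_S\log p$, $K\le p^a$, $$\lambda_0\ge C\sqrt{\frac{\log p}{N}}\qquad\text{and}\qquad\lambda_1\ge C\,\frac{n_S}{N}\sqrt{\frac{\log p}{n_S}},$$ then with probability at least $1-\exp(-c_1\log p)$ the fused-penalty problem has a solution, and its set of solutions equals the set of solutions of the oracle problem. -/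

import Mathlib

open MeasureTheory ProbabilityTheory
open scoped NNReal Matrix

namespace AdaTrans

/-- Parameters of the multi-task model: the target parameter `β` and the `K` target-source
contrasts `δ⁽¹⁾, …, δ⁽ᴷ⁾`, all in `ℝᵖ`. -/
abbrev Param (K p : ℕ) : Type := (Fin p → ℝ) × (Fin K → Fin p → ℝ)

/-- Sample sizes: task `0` is the target (size `nT`), tasks `1, …, K` are the sources (size `nS`). -/
def sampleSize (K nT nS : ℕ) : Fin (K + 1) → ℕ := Fin.cons nT (fun _ => nS)

/-- The total sample size `N = K nS + nT`. -/
def totalSize (K nT nS : ℕ) : ℕ := K * nS + nT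

/-- One feature matrix for each task. -/
abbrev Design (K nT nS p : ℕ) : Type :=
  (k : Fin (K + 1)) → Matrix (Fin (sampleSize K nT nS k)) (Fin p) ℝ

/-- One vector of length the sample size for each task. -/
abbrev Sample (K nT nS : ℕ) : Type :=
  (k : Fin (K + 1)) → Fin (sampleSize K nT nS k) → ℝ

/-- The coefficient of task `k`: `β + δ⁽ᵏ⁾`, with the convention `δ⁽⁰⁾ = 0`. -/
def taskCoef {K p : ℕ} (θ : Param K p) (k : Fin (K + 1)) : Fin p → ℝ :=
  θ.1 + (Fin.cons 0 θ.2 : Fin (K + 1) → Fin p → ℝ) k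

/-- The responses of the linear models `y⁽ᵏ⁾ = X⁽ᵏ⁾ (β + δ⁽ᵏ⁾) + ε⁽ᵏ⁾`, `0 ≤ k ≤ K`. -/
def response {K nT nS p : ℕ} (X : Design K nT nS p) (ε : Sample K nT nS) (θ : Param K p) :
    Sample K nT nS :=
  fun k => X k *ᵥ taskCoef θ k + ε k

/-- The parameter blocks `(β, δ⁽¹⁾, …, δ⁽ᴷ⁾)`, indexed by `0, 1, …, K`. -/
def block {K p : ℕ} (θ : Param K p) : Fin (K + 1) → Fin p → ℝ := Fin.cons θ.1 θ.2

/-- The index sets `S₀ = {j | β_j ≠ 0}` and `S_k = {j | δ⁽ᵏ⁾_j ≠ 0}`. -/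
def supp {K p : ℕ} (θ : Param K p) (k : Fin (K + 1)) : Set (Fin p) := {j | block θ k j ≠ 0}

/-- The loss `(1/N) ∑_{k=0}^K ‖y⁽ᵏ⁾ - X⁽ᵏ⁾ (β + δ⁽ᵏ⁾)‖₂²`. -/
noncomputable def loss {K nT nS p : ℕ} (X : Design K nT nS p) (y : Sample K nT nS)
    (θ : Param K p) : ℝ :=
  1 / (totalSize K nT nS : ℝ) * ∑ k, ∑ i, (y k i - (X k *ᵥ taskCoef θ k) i) ^ 2

/-- The objective of the weighted fused-penalty problem. -/
noncomputable def objective {K nT nS p : ℕ} (X : Design K nT nS p) (y : Sample K nT nS)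
    (lam₀ lam₁ : ℝ) (w : Fin (K + 1) → Fin p → ℝ) (θ : Param K p) : ℝ :=
  loss X y θ + lam₀ * ∑ j, w 0 j * |θ.1 j| + lam₁ * ∑ k : Fin K, ∑ j, w k.succ j * |θ.2 k j|

/-- The solutions of the (unconstrained) weighted fused-penalty problem. -/
def fusedSolutions {K nT nS p : ℕ} (X : Design K nT nS p) (y : Sample K nT nS)
    (lam₀ lam₁ : ℝ) (w : Fin (K + 1) → Fin p → ℝ) : Set (Param K p) :=
  {θ | IsMinOn (objective X y lam₀ lam₁ w) Set.univ θ}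

/-- The constraint set `β_{S₀ᶜ} = 0`, `δ⁽ᵏ⁾_{S_kᶜ} = 0` for given index sets `S₀, …, S_K`. -/
def oracleFeasible {K p : ℕ} (S : Fin (K + 1) → Set (Fin p)) : Set (Param K p) :=
  {θ | ∀ k, ∀ j ∈ (S k)ᶜ, block θ k j = 0}

/-- The oracle estimators: the solutions of least squares constrained to `oracleFeasible S`. -/
def oracleSolutions {K nT nS p : ℕ} (X : Design K nT nS p) (y : Sample K nT nS)
    (S : Fin (K + 1) → Set (Fin p)) : Set (Param K p) :=
  {θ | θ ∈ oracleFeasible S ∧ IsMinOn (loss X y) (oracleFeasible S) θ}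

/-- The weights `w_j⁽ᵏ⁾ = 1{j ∈ S_kᶜ}`, `0 ≤ k ≤ K`. -/
noncomputable def oracleWeight {K p : ℕ} (S : Fin (K + 1) → Set (Fin p)) :
    Fin (K + 1) → Fin p → ℝ :=
  fun k => (S k)ᶜ.indicator 1

/-- A random vector `x` in `ℝᵖ` is centred sub-Gaussian with constant `τ`:
`E exp(t ⟨v, x⟩) ≤ exp(τ ‖v‖₂² t² / 2)` for all `v ∈ ℝᵖ` and `t ∈ ℝ`. -/
def IsSubGaussianVector {Ω : Type*} [MeasurableSpace Ω] {p : ℕ} (x : Ω → Fin p → ℝ) (τ : ℝ≥0)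
    (P : Measure Ω) : Prop :=
  ∀ v : EuclideanSpace ℝ (Fin p),
    HasSubgaussianMGF (fun ω => ∑ j, v j * x ω j) (τ * ‖v‖₊ ^ 2) P

/-- Design assumption. All the rows `X⁽ᵏ⁾_{i·}` are independent sub-Gaussian vectors with mean zero
and covariance `Σ⁽ᵏ⁾`, whose eigenvalues lie in `[1/c, c]`. -/
structure DesignAssumption {Ω : Type*} [MeasurableSpace Ω] {K nT nS p : ℕ} (P : Measure Ω)
    (X : Ω → Design K nT nS p) (Sig : Fin (K + 1) → Matrix (Fin p) (Fin p) ℝ)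
    (τ : ℝ≥0) (c : ℝ) : Prop where
  measurable : ∀ k i, Measurable (fun ω => X ω k i)
  indep : iIndepFun
    (fun (r : (k : Fin (K + 1)) × Fin (sampleSize K nT nS k)) ω => X ω r.1 r.2) P
  subGaussian : ∀ k i, IsSubGaussianVector (fun ω => X ω k i) τ P
  mean_zero : ∀ k i j, ∫ ω, X ω k i j ∂P = 0
  covariance_eq : ∀ k i j l, cov[fun ω => X ω k i j, fun ω => X ω k i l; P] = Sig k j l
  eigenvalues_bound : ∀ k, ∀ μ ∈ spectrum ℝ (Sig k), 1 / c ≤ μ ∧ μ ≤ c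

/-- Noise assumption. All the `ε⁽ᵏ⁾_i` are independent centred Gaussian variables with variance
`σ_k ≤ c`, and the noise is independent of the features. -/
structure NoiseAssumption {Ω : Type*} [MeasurableSpace Ω] {K nT nS p : ℕ} (P : Measure Ω)
    (X : Ω → Design K nT nS p) (ε : Ω → Sample K nT nS) (σ : Fin (K + 1) → ℝ≥0)
    (c : ℝ) : Prop where
  measurable : ∀ k i, Measurable (fun ω => ε ω k i)
  indep : iIndepFun
    (fun (r : (k : Fin (K + 1)) × Fin (sampleSize K nT nS k)) ω => ε ω r.1 r.2) P
  gaussian : ∀ k i, P.map (fun ω => ε ω k i) = gaussianReal 0 (σ k)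
  variance_le : ∀ k, (σ k : ℝ) ≤ c
  indep_design : IndepFun
    (fun ω (r : (k : Fin (K + 1)) × Fin (sampleSize K nT nS k)) => X ω r.1 r.2)
    (fun ω (r : (k : Fin (K + 1)) × Fin (sampleSize K nT nS k)) => ε ω r.1 r.2) P

end AdaTrans

/-! Primal-dual witness argument. The weights vanish on the true supports, so the penalty charges
only coordinates the oracle sets to zero. Stack all tasks into one regression and let `r` be the
response minus its projection onto the span of the oracle columns. The fused objective is then the
oracle minimum, plus a nonnegative squared distance between fitted values, plus a gap collecting the
off-support coordinates. If each column satisfies `2/N * |⟨column, r⟩| < penalty level`, the gap is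
nonnegative and vanishes only at feasible parameters. Hence the two solution sets agree, without any
uniqueness or invertibility (`fusedSolutions_eq_oracleSolutions`).

It remains to verify this strict dual feasibility with high probability. The true parameter is
feasible, so `r` is the noise with its oracle part projected out. Given the design, `⟨column, r⟩` is
a linear combination of Gaussians with variance at most `c` times the squared column norm. That norm
is of the order of the block's sample size, by a Chernoff bound for sums of squares.
`measure_inner_oracleResidual_ge_le` combines the two tails, and a union bound runs over the `(K +
1) p` columns. -/

namespace AdaTrans

/-! ### Exponential moments of squares and Chernoff bounds. -/

/-- The square of a sub-Gaussian variable has a moment generating function which is bounded at some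
positive point, uniformly over all variables with the same sub-Gaussian constant. -/
lemma exists_mgf_sq_le (τ : ℝ≥0) :
    ∃ s : ℝ, 0 < s ∧ ∃ B : ℝ, 1 ≤ B ∧ ∀ (Ω : Type*) [MeasurableSpace Ω] (P : Measure Ω)
      [IsProbabilityMeasure P] (X : Ω → ℝ), Measurable X → HasSubgaussianMGF X τ P →
      Integrable (fun ω => Real.exp (s * X ω ^ 2)) P ∧ mgf (fun ω => X ω ^ 2) P s ≤ B := by
  obtain ⟨C, hC, hint⟩ := IsGaussian.exists_integrable_exp_sq (gaussianReal 0 1)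
  set s : ℝ := C / (τ + 1) with hs
  have hs0 : 0 < s := by positivity
  have hτs : τ * s ≤ C := by
    rw [hs, mul_div_assoc', div_le_iff₀ (by positivity)]
    nlinarith [τ.coe_nonneg]
  refine ⟨s, hs0, max 1 (∫ g, Real.exp (C * ‖g‖ ^ 2) ∂gaussianReal 0 1), le_max_left _ _, ?_⟩
  intro Ω _ P _ X hX hsub
  have ha : √(2 * s) ^ 2 = 2 * s := Real.sq_sqrt (by positivity)
  -- Gaussian linearisation: `exp (s x²)` is the mean of `exp (√(2s) x g)` for standard Gaussian
  -- `g`. Swapping the integrals and using the sub-Gaussian bound leaves the mean of `exp (τ s g²)`,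
  -- finite by Fernique since `τ s ≤ C`. Working with `∫⁻` yields integrability as well.
  have key : ∫⁻ ω, ENNReal.ofReal (Real.exp (s * X ω ^ 2)) ∂P
      ≤ ENNReal.ofReal (∫ g, Real.exp (C * ‖g‖ ^ 2) ∂gaussianReal 0 1) := by
    have h1 (ω : Ω) : ENNReal.ofReal (Real.exp (s * X ω ^ 2))
        = ∫⁻ g, ENNReal.ofReal (Real.exp (√(2 * s) * X ω * g)) ∂gaussianReal 0 1 := by
      rw [← ofReal_integral_eq_lintegral_ofReal (integrable_exp_mul_gaussianReal _)
        (ae_of_all _ fun _ => (Real.exp_pos _).le)]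
      have h := congrFun (mgf_fun_id_gaussianReal (μ := 0) (v := 1)) (√(2 * s) * X ω)
      rw [mgf] at h
      rw [h, mul_pow, ha]
      congr 2
      push_cast
      ring
    simp_rw [h1]
    rw [lintegral_lintegral_swap (by
      refine Measurable.aemeasurable ?_
      unfold Function.uncurry
      fun_prop), ofReal_integral_eq_lintegral_ofReal hint (ae_of_all _ fun _ => (Real.exp_pos _).le)]
    refine lintegral_mono fun g => ?_
    have h2 : ∀ ω, √(2 * s) * X ω * g = (√(2 * s) * g) * X ω := fun ω => by ring
    simp_rw [h2]
    rw [← ofReal_integral_eq_lintegral_ofReal (hsub.integrable_exp_mul _)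
      (ae_of_all _ fun _ => (Real.exp_pos _).le)]
    refine ENNReal.ofReal_le_ofReal ((hsub.mgf_le _).trans (Real.exp_le_exp.2 ?_))
    rw [mul_pow, ha, Real.norm_eq_abs, sq_abs]
    nlinarith [mul_le_mul_of_nonneg_right hτs (sq_nonneg g)]
  have hi : Integrable (fun ω => Real.exp (s * X ω ^ 2)) P := by
    refine ⟨by fun_prop, ?_⟩
    rw [hasFiniteIntegral_iff_ofReal (ae_of_all _ fun _ => (Real.exp_pos _).le)]
    exact key.trans_lt ENNReal.ofReal_lt_top
  refine ⟨hi, le_max_of_le_right ?_⟩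
  rw [mgf]
  rw [← ofReal_integral_eq_lintegral_ofReal hi (ae_of_all _ fun _ => (Real.exp_pos _).le)] at key
  exact (ENNReal.ofReal_le_ofReal_iff (integral_nonneg fun _ => (Real.exp_pos _).le)).1 key

/-- Chernoff bound for a sum of independent squares. -/
lemma measureReal_sum_sq_ge_le {Ω ι : Type*} [MeasurableSpace Ω] {P : Measure Ω}
    [IsProbabilityMeasure P] {X : ι → Ω → ℝ} (hX : ∀ i, Measurable (X i)) (hind : iIndepFun X P)
    {s B : ℝ} (hs : 0 < s) (hB : 1 ≤ B)
    (h : ∀ i, Integrable (fun ω => Real.exp (s * X i ω ^ 2)) P ∧ mgf (fun ω => X i ω ^ 2) P s ≤ B)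
    (T : Finset ι) (M : ℝ) :
    P.real {ω | M * T.card ≤ ∑ i ∈ T, X i ω ^ 2}
      ≤ Real.exp (-(s * M - Real.log B) * T.card) := by
  have hind' : iIndepFun (fun i ω => X i ω ^ 2) P :=
    hind.comp (fun _ x => x ^ 2) fun _ => by fun_prop
  have hm : ∀ i, Measurable fun ω => X i ω ^ 2 := fun i => (hX i).pow_const 2
  have hint := hind'.integrable_exp_mul_sum (t := s) hm (s := T) fun i _ => (h i).1
  have hc := measure_ge_le_exp_mul_mgf (M * T.card) hs.le hint
  rw [hind'.mgf_sum hm] at hc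
  simp only [Finset.sum_apply] at hc
  refine hc.trans ?_
  have hp : ∏ i ∈ T, mgf (fun ω => X i ω ^ 2) P s ≤ B ^ T.card :=
    (Finset.prod_le_prod (fun _ _ => mgf_nonneg) fun i _ => (h i).2).trans_eq (by simp)
  refine (mul_le_mul_of_nonneg_left hp (Real.exp_pos _).le).trans_eq ?_
  rw [← Real.exp_log (lt_of_lt_of_le one_pos hB), ← Real.exp_nat_mul, ← Real.exp_add, Real.log_exp]
  congr 1
  ring

/-- Two-sided Chernoff bound for a sub-Gaussian variable. -/
lemma measureReal_abs_ge_le_of_hasSubgaussianMGF {Ω : Type*} [MeasurableSpace Ω] {P : Measure Ω}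
    [IsFiniteMeasure P] {Y : Ω → ℝ} {v : ℝ≥0} (h : HasSubgaussianMGF Y v P) {t : ℝ} (ht : 0 ≤ t) :
    P.real {ω | t ≤ |Y ω|} ≤ 2 * Real.exp (-t ^ 2 / (2 * v)) := by
  have hsub : {ω | t ≤ |Y ω|} ⊆ {ω | t ≤ Y ω} ∪ {ω | t ≤ (-Y) ω} := fun ω hω => by
    simpa [le_abs] using hω
  refine (measureReal_mono hsub).trans ((measureReal_union_le _ _).trans ?_)
  rw [two_mul]
  exact add_le_add (h.measure_ge_le ht) (h.neg.measure_ge_le ht)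

/-- Tail bound for a linear combination of independent centred Gaussian variables. -/
lemma measureReal_abs_sum_mul_gaussian_ge_le {Ω ι : Type*} [Fintype ι] [MeasurableSpace Ω]
    {P : Measure Ω} [IsProbabilityMeasure P] {ε : ι → Ω → ℝ} (hε : ∀ i, Measurable (ε i))
    (hind : iIndepFun ε P) {σ : ι → ℝ≥0} (hg : ∀ i, P.map (ε i) = gaussianReal 0 (σ i)) {c : ℝ≥0}
    (hσ : ∀ i, σ i ≤ c) (v : ι → ℝ) {b : ℝ≥0} (hb : ∑ i, v i ^ 2 ≤ b) {t : ℝ} (ht : 0 ≤ t) :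
    P.real {ω | t ≤ |∑ i, v i * ε i ω|} ≤ 2 * Real.exp (-t ^ 2 / (2 * (c * b))) := by
  have hs : ∀ i, HasSubgaussianMGF (ε i) (σ i) P := fun i => by
    rw [← HasSubgaussianMGF.id_map_iff (hε i).aemeasurable, hg i]
    refine ⟨fun t => integrable_exp_mul_gaussianReal t, fun t => ?_⟩
    rw [mgf_id_gaussianReal]
    simp
  have h1 := HasSubgaussianMGF.sum_of_iIndepFun (s := Finset.univ)
    (hind.comp (fun i x => v i * x) fun i => by fun_prop) fun i _ => (hs i).const_mul (v i)
  have h2 : HasSubgaussianMGF (fun ω => ∑ i, v i * ε i ω) (c * b) P := by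
    refine ⟨h1.integrable_exp_mul, fun t => (h1.mgf_le t).trans (Real.exp_le_exp.2 ?_)⟩
    have hle : ∑ i, v i ^ 2 * (σ i : ℝ) ≤ c * b := by
      calc ∑ i, v i ^ 2 * (σ i : ℝ) ≤ ∑ i, v i ^ 2 * (c : ℝ) :=
            Finset.sum_le_sum fun i _ => mul_le_mul_of_nonneg_left (hσ i) (sq_nonneg _)
        _ = c * ∑ i, v i ^ 2 := by rw [← Finset.sum_mul, mul_comm]
        _ ≤ c * b := mul_le_mul_of_nonneg_left hb c.2
    push_cast
    gcongr
    exact hle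
  simpa using measureReal_abs_ge_le_of_hasSubgaussianMGF h2 ht

/-! ### Measurability of projections onto random subspaces. -/

/-- The distance to the span of finitely many measurable random vectors is measurable. -/
lemma measurable_norm_sub_starProjection_span {Z ι E : Type*} [MeasurableSpace Z] [Finite ι]
    [NormedAddCommGroup E] [InnerProductSpace ℝ E] [FiniteDimensional ℝ E] [MeasurableSpace E]
    [BorelSpace E] {a : ι → Z → E} (ha : ∀ i, Measurable (a i)) {w : Z → E} (hw : Measurable w) :
    Measurable fun z => ‖w z - (Submodule.span ℝ (Set.range fun i => a i z)).starProjection (w z)‖ := by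
  cases nonempty_fintype ι
  refine measurable_of_Iio fun r => ?_
  -- Being closer than `r` to the span is an open condition on the coefficients, so rational ones
  -- suffice and the union is countable.
  have : ((fun z => ‖w z - (Submodule.span ℝ (Set.range fun i => a i z)).starProjection (w z)‖) ⁻¹'
      Set.Iio r) = ⋃ q : ι → ℚ, {z | ‖w z - ∑ i, (q i : ℝ) • a i z‖ < r} := by
    ext z
    simp only [Set.mem_preimage, Set.mem_Iio, Set.mem_iUnion, Set.mem_ofPred_eq]
    constructor
    · intro h
      obtain ⟨x, hx⟩ := (Submodule.mem_span_range_iff_exists_fun ℝ).1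
        (Submodule.starProjection_apply_mem (Submodule.span ℝ (Set.range fun i => a i z)) (w z))
      have hopen : IsOpen {x : ι → ℝ | ‖w z - ∑ i, x i • a i z‖ < r} :=
        isOpen_lt (by fun_prop) continuous_const
      have hd : DenseRange (Pi.map fun (_ : ι) (q : ℚ) => (q : ℝ)) :=
        DenseRange.piMap fun _ => Rat.denseRange_cast
      obtain ⟨q, hq⟩ := hd.exists_mem_open hopen ⟨x, by simpa [hx] using h⟩
      exact ⟨q, hq⟩
    · rintro ⟨q, hq⟩
      refine lt_of_le_of_lt ?_ hq
      rw [Submodule.starProjection_minimal]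
      refine ciInf_le ⟨0, by rintro _ ⟨_, rfl⟩; positivity⟩
        (⟨∑ i, (q i : ℝ) • a i z, Submodule.sum_mem _ fun i _ =>
          Submodule.smul_mem _ _ (Submodule.subset_span ⟨i, rfl⟩)⟩ :
          Submodule.span ℝ (Set.range fun i => a i z))
  rw [this]
  exact MeasurableSet.iUnion fun q => measurableSet_lt (by fun_prop) measurable_const

/-- The residual of `w` is orthogonal to the span, so `u` may be replaced by its own residual;
polarisation then reduces to distances. -/
lemma measurable_inner_sub_starProjection_span {Z ι E : Type*} [MeasurableSpace Z] [Finite ι]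
    [NormedAddCommGroup E] [InnerProductSpace ℝ E] [FiniteDimensional ℝ E] [MeasurableSpace E]
    [BorelSpace E] {a : ι → Z → E} (ha : ∀ i, Measurable (a i)) {u w : Z → E} (hu : Measurable u)
    (hw : Measurable w) :
    Measurable fun z =>
      inner ℝ (u z) (w z - (Submodule.span ℝ (Set.range fun i => a i z)).starProjection (w z)) := by
  have h1 := measurable_norm_sub_starProjection_span ha (hu.add hw)
  have h2 := measurable_norm_sub_starProjection_span ha (hu.sub hw)
  convert! ((h1.pow_const 2).sub (h2.pow_const 2)).div_const 4 using 2 with z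
  set V := Submodule.span ℝ (Set.range fun i => a i z)
  have h3 : inner ℝ (V.starProjection (u z)) (w z - V.starProjection (w z)) = 0 := by
    rw [real_inner_comm]
    exact V.starProjection_inner_eq_zero _ _ (V.starProjection_apply_mem _)
  have h4 : inner ℝ (u z) (w z - V.starProjection (w z))
      = inner ℝ (u z - V.starProjection (u z)) (w z - V.starProjection (w z)) := by
    rw [inner_sub_left, h3, sub_zero]
  change _ = (‖u z + w z - V.starProjection (u z + w z)‖ ^ 2
    - ‖u z - w z - V.starProjection (u z - w z)‖ ^ 2) / 4
  rw [h4, map_add, map_sub, add_sub_add_comm, sub_sub_sub_comm]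
  generalize u z - V.starProjection (u z) = e, w z - V.starProjection (w z) = f
  rw [norm_add_sq_real, norm_sub_sq_real]
  ring

/-! ### The stacked regression and the deterministic equivalence. -/

variable {K nT nS p : ℕ}

/-- The index set of all observations. -/
abbrev Row (K nT nS : ℕ) : Type := (k : Fin (K + 1)) × Fin (sampleSize K nT nS k)

/-- The column of the stacked design which belongs to the `j`-th coordinate of block `k`: all tasks
for the target block `k = 0`, and task `k` only for a contrast. -/
noncomputable def stackedCol (x : Row K nT nS → Fin p → ℝ) (k : Fin (K + 1)) (j : Fin p) :
    EuclideanSpace ℝ (Row K nT nS) :=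
  WithLp.toLp 2 fun r => if k = 0 ∨ k = r.1 then x r j else 0

/-- The stacked fitted values. -/
noncomputable def fit (x : Row K nT nS → Fin p → ℝ) (θ : Param K p) :
    EuclideanSpace ℝ (Row K nT nS) :=
  ∑ k, ∑ j, block θ k j • stackedCol x k j

/-- The span of the columns of the stacked design which the oracle may use. -/
noncomputable def oracleSpan (x : Row K nT nS → Fin p → ℝ) (S : Fin (K + 1) → Set (Fin p)) :
    Submodule ℝ (EuclideanSpace ℝ (Row K nT nS)) :=
  Submodule.span ℝ (Set.range fun q : {q : Fin (K + 1) × Fin p // q.2 ∈ S q.1} =>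
    stackedCol x q.1.1 q.1.2)

lemma taskCoef_eq_sum (θ : Param K p) (k : Fin (K + 1)) (j : Fin p) :
    taskCoef θ k j = ∑ l, if l = 0 ∨ l = k then block θ l j else 0 := by
  rw [Fin.sum_univ_succ]
  refine Fin.cases ?_ (fun i => ?_) k
  · simp [taskCoef, block, Fin.succ_ne_zero]
  · simp [taskCoef, block, Fin.succ_ne_zero]

lemma fit_apply (X : Design K nT nS p) (θ : Param K p) (r : Row K nT nS) :
    fit (fun r => X r.1 r.2) θ r = (X r.1 *ᵥ taskCoef θ r.1) r.2 := by
  simp only [fit, stackedCol, Matrix.mulVec, dotProduct, taskCoef_eq_sum, Finset.mul_sum,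
    WithLp.ofLp_sum, WithLp.ofLp_smul, Finset.sum_apply, Pi.smul_apply, smul_eq_mul]
  rw [Finset.sum_comm]
  refine Finset.sum_congr rfl fun j _ => Finset.sum_congr rfl fun k _ => ?_
  split_ifs <;> ring

lemma loss_eq (X : Design K nT nS p) (y : Sample K nT nS) (θ : Param K p) :
    loss X y θ = 1 / (totalSize K nT nS : ℝ) *
      ‖WithLp.toLp 2 (fun r : Row K nT nS => y r.1 r.2) - fit (fun r => X r.1 r.2) θ‖ ^ 2 := by
  rw [loss, EuclideanSpace.norm_sq_eq, Fintype.sum_sigma]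
  simp [fit_apply]

lemma fit_mem_oracleSpan (x : Row K nT nS → Fin p → ℝ) {S : Fin (K + 1) → Set (Fin p)}
    {θ : Param K p} (h : θ ∈ oracleFeasible S) : fit x θ ∈ oracleSpan x S := by
  refine Submodule.sum_mem _ fun k _ => Submodule.sum_mem _ fun j _ => ?_
  by_cases hj : j ∈ S k
  · exact Submodule.smul_mem _ _ (Submodule.subset_span ⟨⟨(k, j), hj⟩, rfl⟩)
  · rw [h k j hj, zero_smul]
    exact Submodule.zero_mem _

lemma exists_fit_eq (x : Row K nT nS → Fin p → ℝ) (S : Fin (K + 1) → Set (Fin p))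
    {v : EuclideanSpace ℝ (Row K nT nS)} (hv : v ∈ oracleSpan x S) :
    ∃ θ ∈ oracleFeasible S, fit x θ = v := by
  classical
  obtain ⟨b, rfl⟩ := (Submodule.mem_span_range_iff_exists_fun ℝ).1 hv
  let B : Fin (K + 1) → Fin p → ℝ := fun k j => if h : j ∈ S k then b ⟨(k, j), h⟩ else 0
  have hB : block (B 0, fun k => B k.succ) = B := by
    funext k
    refine Fin.cases ?_ (fun i => ?_) k <;> simp [block]
  refine ⟨(B 0, fun k => B k.succ), fun k j hj => ?_, ?_⟩
  · rw [hB]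
    exact dif_neg hj
  · rw [fit, hB, ← Fintype.sum_prod_type' (f := fun k j => B k j • stackedCol x k j),
      ← Fintype.sum_subtype_add_sum_subtype (fun q : Fin (K + 1) × Fin p => q.2 ∈ S q.1),
      Fintype.sum_eq_zero (fun q : {q : Fin (K + 1) × Fin p // q.2 ∉ S q.1} => _)
        (fun q => by simp [B, q.2]), add_zero]
    exact Finset.sum_congr rfl fun q _ => by simp [B, q.2]

/-- The penalty level of a block. -/
def penaltyLevel (lam₀ lam₁ : ℝ) (k : Fin (K + 1)) : ℝ := if k = 0 then lam₀ else lam₁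

lemma objective_eq (X : Design K nT nS p) (y : Sample K nT nS) (lam₀ lam₁ : ℝ)
    (w : Fin (K + 1) → Fin p → ℝ) (θ : Param K p) :
    objective X y lam₀ lam₁ w θ
      = loss X y θ + ∑ k, ∑ j, w k j * (penaltyLevel lam₀ lam₁ k * |block θ k j|) := by
  rw [objective, Fin.sum_univ_succ, add_assoc]
  simp only [penaltyLevel, block, Fin.succ_ne_zero, if_true, if_false, Fin.cons_zero,
    Fin.cons_succ, Finset.mul_sum]
  simp only [mul_left_comm]

/-- If the residuals of the oracle estimator satisfy the strict dual feasibility condition, then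
the fused-penalty problem and the oracle problem have the same solutions. -/
lemma fusedSolutions_eq_oracleSolutions (X : Design K nT nS p) (y : Sample K nT nS)
    (lam₀ lam₁ : ℝ) (S : Fin (K + 1) → Set (Fin p)) (r : EuclideanSpace ℝ (Row K nT nS))
    (hr : r ∈ (oracleSpan (fun r => X r.1 r.2) S)ᗮ)
    (hyr : WithLp.toLp 2 (fun r : Row K nT nS => y r.1 r.2) - r
      ∈ oracleSpan (fun r => X r.1 r.2) S)
    (hdual : ∀ k j, 2 / (totalSize K nT nS : ℝ)
      * |inner ℝ (stackedCol (fun r => X r.1 r.2) k j) r| < penaltyLevel lam₀ lam₁ k) :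
    (fusedSolutions X y lam₀ lam₁ (oracleWeight S)).Nonempty ∧
      fusedSolutions X y lam₀ lam₁ (oracleWeight S) = oracleSolutions X y S := by
  set x : Row K nT nS → Fin p → ℝ := fun r => X r.1 r.2 with hx
  set Y : EuclideanSpace ℝ (Row K nT nS) := WithLp.toLp 2 (fun r => y r.1 r.2) with hY
  set N : ℝ := (totalSize K nT nS : ℝ) with hN
  obtain ⟨θ₀, hθ₀, hfit⟩ := exists_fit_eq x S hyr
  -- the gap between the gradient and the penalty, coordinate by coordinate
  let gap : Param K p → ℝ := fun θ => ∑ k, ∑ j, oracleWeight S k j *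
    (penaltyLevel lam₀ lam₁ k * |block θ k j|
      - 2 / N * (block θ k j * inner ℝ (stackedCol x k j) r))
  have hloss₀ : loss X y θ₀ = 1 / N * ‖r‖ ^ 2 := by
    rw [loss_eq, ← hY, ← hx, hfit, sub_sub_cancel]
  have hloss (θ : Param K p) : loss X y θ = 1 / N * ‖r‖ ^ 2
      - 2 / N * inner ℝ (fit x θ) r + 1 / N * ‖fit x θ - (Y - r)‖ ^ 2 := by
    have h1 : Y - fit x θ = r - (fit x θ - (Y - r)) := by abel
    have h2 : inner ℝ (Y - r) r = 0 := hr _ hyr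
    rw [loss_eq, ← hY, ← hx, ← hN, h1, norm_sub_sq_real, inner_sub_right, real_inner_comm,
      real_inner_comm (Y - r) r, h2]
    ring
  -- The weights can be inserted for free: on-support columns are orthogonal to `r`, and off-support
  -- weights are 1.
  have hinner (θ : Param K p) : inner ℝ (fit x θ) r
      = ∑ k, ∑ j, oracleWeight S k j * (block θ k j * inner ℝ (stackedCol x k j) r) := by
    simp only [fit, sum_inner, real_inner_smul_left]
    refine Finset.sum_congr rfl fun k _ => Finset.sum_congr rfl fun j _ => ?_
    by_cases hj : j ∈ S k
    · have : inner ℝ (stackedCol x k j) r = 0 :=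
        hr _ (Submodule.subset_span ⟨⟨(k, j), hj⟩, rfl⟩)
      simp [this]
    · simp [oracleWeight, hj]
  have hobj (θ : Param K p) : objective X y lam₀ lam₁ (oracleWeight S) θ
      = loss X y θ₀ + 1 / N * ‖fit x θ - (Y - r)‖ ^ 2 + gap θ := by
    rw [objective_eq, hloss, hinner, hloss₀]
    simp only [gap, mul_sub, Finset.sum_sub_distrib,
      Finset.mul_sum, mul_left_comm (2 / N)]
    ring
  have hfeas (θ : Param K p) (h : θ ∈ oracleFeasible S) :
      objective X y lam₀ lam₁ (oracleWeight S) θ = loss X y θ := by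
    rw [objective_eq, Finset.sum_eq_zero, add_zero]
    refine fun k _ => Finset.sum_eq_zero fun j _ => ?_
    by_cases hj : j ∈ S k
    · simp [oracleWeight, hj]
    · simp [h k j hj]
  have hterm (θ : Param K p) (k : Fin (K + 1)) (j : Fin p) :
      (penaltyLevel lam₀ lam₁ k - 2 / N * |inner ℝ (stackedCol x k j) r|) * |block θ k j|
      ≤ penaltyLevel lam₀ lam₁ k * |block θ k j|
        - 2 / N * (block θ k j * inner ℝ (stackedCol x k j) r) := by
    have h1 := le_abs_self (block θ k j * inner ℝ (stackedCol x k j) r)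
    rw [abs_mul] at h1
    have h2 := mul_le_mul_of_nonneg_left h1 (show 0 ≤ 2 / N by positivity)
    nlinarith
  have hw (k : Fin (K + 1)) (j : Fin p) : 0 ≤ oracleWeight S k j :=
    Set.indicator_nonneg (fun _ _ => zero_le_one) _
  have hterm0 (θ : Param K p) (k : Fin (K + 1)) (j : Fin p) : 0 ≤ oracleWeight S k j *
      (penaltyLevel lam₀ lam₁ k * |block θ k j|
        - 2 / N * (block θ k j * inner ℝ (stackedCol x k j) r)) :=
    mul_nonneg (hw k j) ((mul_nonneg (sub_pos.2 (hdual k j)).le (abs_nonneg _)).trans (hterm θ k j))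
  have hgap (θ : Param K p) : 0 ≤ gap θ :=
    Finset.sum_nonneg fun k _ => Finset.sum_nonneg fun j _ => hterm0 θ k j
  have hgap_pos (θ : Param K p) (h : gap θ = 0) : θ ∈ oracleFeasible S := by
    intro k j hj
    have h1 := (Finset.sum_eq_zero_iff_of_nonneg fun k _ =>
      Finset.sum_nonneg fun j _ => hterm0 θ k j).1 h k (Finset.mem_univ _)
    have h2 := (Finset.sum_eq_zero_iff_of_nonneg fun j _ => hterm0 θ k j).1 h1 j (Finset.mem_univ _)
    rw [oracleWeight, Set.indicator_of_mem hj, Pi.one_apply, one_mul] at h2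
    have h3 := (hterm θ k j).trans_eq h2
    by_contra hne
    exact absurd h3 (not_le.2 (mul_pos (sub_pos.2 (hdual k j)) (abs_pos.2 hne)))
  have hmin (θ : Param K p) : loss X y θ₀ ≤ objective X y lam₀ lam₁ (oracleWeight S) θ := by
    rw [hobj]
    have := hgap θ
    have : 0 ≤ 1 / N * ‖fit x θ - (Y - r)‖ ^ 2 := by positivity
    linarith
  have hθ₀min : θ₀ ∈ fusedSolutions X y lam₀ lam₁ (oracleWeight S) := fun θ _ =>
    (hfeas θ₀ hθ₀).trans_le (hmin θ)
  refine ⟨⟨θ₀, hθ₀min⟩, Set.Subset.antisymm (fun θ hθ => ?_) fun θ hθ => ?_⟩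
  · have h1 : objective X y lam₀ lam₁ (oracleWeight S) θ ≤ loss X y θ₀ :=
      (hθ (Set.mem_univ θ₀)).trans_eq (hfeas θ₀ hθ₀)
    have hf : θ ∈ oracleFeasible S := by
      refine hgap_pos θ (le_antisymm ?_ (hgap θ))
      have : 0 ≤ 1 / N * ‖fit x θ - (Y - r)‖ ^ 2 := by positivity
      rw [hobj] at h1
      linarith
    refine ⟨hf, fun θ' hθ' => ?_⟩
    have h2 := hmin θ'
    rw [hfeas θ' hθ'] at h2
    rw [hfeas θ hf] at h1
    exact h1.trans h2
  · intro θ' _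
    have h1 : loss X y θ ≤ loss X y θ₀ := hθ.2 hθ₀
    exact (hfeas θ hθ.1).trans_le (h1.trans (hmin θ'))

/-! ### Tail bound for the dual variables. -/

/-- Conditioning on one of two independent variables: if an event has conditional probability at
most `q` off a set `A` of values of the first variable, its probability is at most `P(U ∈ A) + q`. -/
lemma measure_le_of_indepFun {Ω α β : Type*} [MeasurableSpace Ω] [MeasurableSpace α]
    [MeasurableSpace β] {P : Measure Ω} [IsProbabilityMeasure P] {U : Ω → α} {W : Ω → β}
    (hU : Measurable U) (hW : Measurable W) (hUW : IndepFun U W P) {H : Set (α × β)}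
    (hH : MeasurableSet H) {A : Set α} (hA : MeasurableSet A) {q : ENNReal}
    (h : ∀ x ∉ A, P {ω | (x, W ω) ∈ H} ≤ q) :
    P {ω | (U ω, W ω) ∈ H} ≤ P {ω | U ω ∈ A} + q := by
  have : IsProbabilityMeasure (P.map U) := Measure.isProbabilityMeasure_map hU.aemeasurable
  have : IsProbabilityMeasure (P.map W) := Measure.isProbabilityMeasure_map hW.aemeasurable
  have h1 : P {ω | (U ω, W ω) ∈ H} = ((P.map U).prod (P.map W)) H := by
    rw [← hUW.map_prod_eq_prod_map_map hU.aemeasurable hW.aemeasurable,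
      Measure.map_apply (hU.prodMk hW) hH]
    rfl
  have h2 : P {ω | U ω ∈ A} = (P.map U) A := (Measure.map_apply hU hA).symm
  rw [h1, h2, Measure.prod_apply hH, ← lintegral_indicator_one hA]
  calc ∫⁻ x, (P.map W) (Prod.mk x ⁻¹' H) ∂P.map U
      ≤ ∫⁻ x, (A.indicator 1 x + q) ∂P.map U := by
        refine lintegral_mono fun x => ?_
        by_cases hx : x ∈ A
        · rw [Set.indicator_of_mem hx]
          exact prob_le_one.trans le_self_add
        · rw [Set.indicator_of_notMem hx, zero_add, Measure.map_apply hW (measurable_prodMk_left hH)]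
          exact h x hx
    _ = ∫⁻ x, A.indicator 1 x ∂P.map U + q := by
        rw [lintegral_add_right _ measurable_const]
        simp

variable {K nT nS p : ℕ}

/-- The number of observations which involve a given block. -/
def blockSize (K nT nS : ℕ) (k : Fin (K + 1)) : ℕ := if k = 0 then totalSize K nT nS else nS

lemma card_filter_row (k : Fin (K + 1)) :
    (Finset.univ.filter fun r : Row K nT nS => k = 0 ∨ k = r.1).card = blockSize K nT nS k := by
  have h : (Finset.univ.filter fun r : Row K nT nS => k = 0 ∨ k = r.1)
      = (Finset.univ.filter fun l => k = 0 ∨ k = l).sigma fun _ => Finset.univ := by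
    ext; simp
  rw [h, Finset.card_sigma]
  simp only [Finset.card_univ, Fintype.card_fin]
  refine Fin.cases ?_ (fun i => ?_) k
  · simp [blockSize, totalSize, Fin.sum_univ_succ, sampleSize, add_comm]
  · simp [blockSize, Fin.succ_ne_zero, sampleSize, Finset.filter_eq]

lemma norm_stackedCol_sq (x : Row K nT nS → Fin p → ℝ) (k : Fin (K + 1)) (j : Fin p) :
    ‖stackedCol x k j‖ ^ 2
      = ∑ r ∈ Finset.univ.filter (fun r : Row K nT nS => k = 0 ∨ k = r.1), x r j ^ 2 := by
  rw [EuclideanSpace.real_norm_sq_eq, Finset.sum_filter]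
  simp [stackedCol, ite_pow]

lemma measurable_stackedCol (k : Fin (K + 1)) (j : Fin p) :
    Measurable fun x : Row K nT nS → Fin p → ℝ => stackedCol x k j := by
  refine (WithLp.measurable_toLp 2 _).comp (measurable_pi_lambda _ fun r => ?_)
  split_ifs <;> fun_prop

/-- The residual of the noise vector after projecting out the oracle columns. -/
noncomputable def oracleResidual (S : Fin (K + 1) → Set (Fin p)) (x : Row K nT nS → Fin p → ℝ)
    (e : Row K nT nS → ℝ) : EuclideanSpace ℝ (Row K nT nS) :=
  WithLp.toLp 2 e - (oracleSpan x S).starProjection (WithLp.toLp 2 e)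

lemma measurable_inner_oracleResidual (S : Fin (K + 1) → Set (Fin p)) (k : Fin (K + 1))
    (j : Fin p) :
    Measurable fun z : (Row K nT nS → Fin p → ℝ) × (Row K nT nS → ℝ) =>
      inner ℝ (stackedCol z.1 k j) (oracleResidual S z.1 z.2) :=
  measurable_inner_sub_starProjection_span
    (a := fun (q : {q : Fin (K + 1) × Fin p // q.2 ∈ S q.1})
      (z : (Row K nT nS → Fin p → ℝ) × (Row K nT nS → ℝ)) => stackedCol z.1 q.1.1 q.1.2)
    (fun _ => (measurable_stackedCol _ _).comp measurable_fst)
    ((measurable_stackedCol _ _).comp measurable_fst)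
    ((WithLp.measurable_toLp 2 _).comp measurable_snd)

/-- The inner product with the oracle residual is a linear combination of the noise variables, whose
coefficients have Euclidean norm at most that of the column. -/
lemma exists_inner_oracleResidual_eq (S : Fin (K + 1) → Set (Fin p)) (x : Row K nT nS → Fin p → ℝ)
    (u : EuclideanSpace ℝ (Row K nT nS)) :
    ∃ v : Row K nT nS → ℝ, ∑ r, v r ^ 2 ≤ ‖u‖ ^ 2 ∧
      ∀ e, inner ℝ u (oracleResidual S x e) = ∑ r, v r * e r := by
  set V := oracleSpan x S
  refine ⟨fun r => (Vᗮ.starProjection u) r, ?_, fun e => ?_⟩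
  · rw [← EuclideanSpace.real_norm_sq_eq]
    gcongr
    exact Vᗮ.norm_starProjection_apply_le u
  · have h : oracleResidual S x e = Vᗮ.starProjection (WithLp.toLp 2 e) := by
      rw [Submodule.starProjection_orthogonal_val]
      rfl
    rw [h, ← Submodule.inner_starProjection_left_eq_right, PiLp.inner_apply]
    exact Finset.sum_congr rfl fun r _ => by simp [mul_comm]

variable {Ω : Type*} [MeasurableSpace Ω] {P : Measure Ω} {X : Ω → Design K nT nS p}
  {ε : Ω → Sample K nT nS} {Sig : Fin (K + 1) → Matrix (Fin p) (Fin p) ℝ}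
  {σ : Fin (K + 1) → ℝ≥0} {τ : ℝ≥0} {c : ℝ}

lemma DesignAssumption.hasSubgaussianMGF_entry (hX : DesignAssumption P X Sig τ c)
    (k : Fin (K + 1)) (i : Fin (sampleSize K nT nS k)) (j : Fin p) :
    HasSubgaussianMGF (fun ω => X ω k i j) τ P := by
  have h := hX.subGaussian k i (EuclideanSpace.single j 1)
  simpa [Pi.single_apply] using h

lemma DesignAssumption.measurable_row (hX : DesignAssumption P X Sig τ c) :
    Measurable fun ω (r : Row K nT nS) => X ω r.1 r.2 :=
  measurable_pi_lambda _ fun r => hX.measurable r.1 r.2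

lemma NoiseAssumption.measurable_row (hε : NoiseAssumption P X ε σ c) :
    Measurable fun ω (r : Row K nT nS) => ε ω r.1 r.2 :=
  measurable_pi_lambda _ fun r => hε.measurable r.1 r.2

/-- Tail bound for the inner product of a stacked column with the oracle residual. -/
lemma measure_inner_oracleResidual_ge_le [IsProbabilityMeasure P] (hc : 0 < c)
    (hX : DesignAssumption P X Sig τ c) (hε : NoiseAssumption P X ε σ c) {s B : ℝ} (hs : 0 < s) (hB : 1 ≤ B)
    (hsB : ∀ f : Ω → ℝ, Measurable f → HasSubgaussianMGF f τ P →
      Integrable (fun ω => Real.exp (s * f ω ^ 2)) P ∧ mgf (fun ω => f ω ^ 2) P s ≤ B)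
    (S : Fin (K + 1) → Set (Fin p)) (k : Fin (K + 1)) (j : Fin p) {M t : ℝ} (hM : 0 ≤ M)
    (ht : 0 ≤ t) :
    P.real {ω | t ≤ |inner ℝ (stackedCol (fun r => X ω r.1 r.2) k j)
        (oracleResidual S (fun r => X ω r.1 r.2) fun r => ε ω r.1 r.2)|}
      ≤ Real.exp (-(s * M - Real.log B) * blockSize K nT nS k)
        + 2 * Real.exp (-t ^ 2 / (2 * (c * (M * blockSize K nT nS k)))) := by
  lift c to ℝ≥0 using hc.le
  lift M to ℝ≥0 using hM
  have hH : MeasurableSet {z : (Row K nT nS → Fin p → ℝ) × (Row K nT nS → ℝ) |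
      t ≤ |inner ℝ (stackedCol z.1 k j) (oracleResidual S z.1 z.2)|} :=
    measurableSet_le measurable_const (measurable_inner_oracleResidual S k j).abs
  -- The exceptional designs are those with too long a column; off this set the Gaussian tail
  -- applies with the design frozen.
  have hA : MeasurableSet {x : Row K nT nS → Fin p → ℝ |
      (M : ℝ) * blockSize K nT nS k ≤ ‖stackedCol x k j‖ ^ 2} :=
    measurableSet_le measurable_const ((measurable_stackedCol k j).norm.pow_const 2)
  have h := measure_le_of_indepFun hX.measurable_row hε.measurable_row hε.indep_design hH hA
    (q := ENNReal.ofReal (2 * Real.exp (-t ^ 2 / (2 * (c * (M * blockSize K nT nS k))))))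
    fun x hx => by
      obtain ⟨v, hv, hve⟩ := exists_inner_oracleResidual_eq S x (stackedCol x k j)
      have hb : ∑ r, v r ^ 2 ≤ ((M * blockSize K nT nS k : ℝ≥0) : ℝ) := by
        push_cast
        exact hv.trans (not_le.1 hx).le
      have hg := measureReal_abs_sum_mul_gaussian_ge_le
        (ε := fun (r : Row K nT nS) ω => ε ω r.1 r.2) (fun r => hε.measurable r.1 r.2) hε.indep
        (fun r => hε.gaussian r.1 r.2) (c := c) (fun r => hε.variance_le r.1) v hb ht
      simp only [Set.mem_ofPred_eq, hve]
      rw [← ofReal_measureReal]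
      refine ENNReal.ofReal_le_ofReal (hg.trans_eq ?_)
      push_cast
      rfl
  have h1 : P.real {ω | (M : ℝ) * blockSize K nT nS k
        ≤ ‖stackedCol (fun r : Row K nT nS => X ω r.1 r.2) k j‖ ^ 2}
      ≤ Real.exp (-(s * M - Real.log B) * blockSize K nT nS k) := by
    have hm (r : Row K nT nS) : Measurable fun ω => X ω r.1 r.2 j :=
      (measurable_pi_apply j).comp (hX.measurable r.1 r.2)
    have h2 := measureReal_sum_sq_ge_le (X := fun (r : Row K nT nS) ω => X ω r.1 r.2 j) hm
      (hX.indep.comp (fun _ x => x j) fun _ => measurable_pi_apply j) hs hB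
      (fun r => hsB _ (hm r) (hX.hasSubgaussianMGF_entry r.1 r.2 j))
      (Finset.univ.filter fun r : Row K nT nS => k = 0 ∨ k = r.1) M
    rw [card_filter_row] at h2
    simpa only [norm_stackedCol_sq] using h2
  rw [← ENNReal.ofReal_le_ofReal_iff (by positivity), ENNReal.ofReal_add (by positivity)
    (by positivity), ofReal_measureReal]
  refine h.trans (add_le_add_left ?_ _)
  rw [← ofReal_measureReal]
  exact ENNReal.ofReal_le_ofReal h1

end AdaTrans

/-! ### Choice of constants and the union bound. -/

theorem theorem1 (c : ℝ) (hc : 0 < c) (τ : ℝ≥0) (cS : ℝ) (hcS : 0 < cS) (a : ℝ) (ha : 0 ≤ a) :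
    ∃ C : ℝ, 0 < C ∧ ∃ c₁ : ℝ, 0 < c₁ ∧
      ∀ (K nT nS p : ℕ), 1 ≤ K → Real.log K ≤ a * Real.log p → cS * Real.log p ≤ nS →
      ∀ (Ω : Type*) [MeasurableSpace Ω] (P : Measure Ω) [IsProbabilityMeasure P]
        (X : Ω → AdaTrans.Design K nT nS p) (ε : Ω → AdaTrans.Sample K nT nS)
        (Sig : Fin (K + 1) → Matrix (Fin p) (Fin p) ℝ) (σ : Fin (K + 1) → ℝ≥0)
        (θ : AdaTrans.Param K p),
      AdaTrans.DesignAssumption P X Sig τ c → AdaTrans.NoiseAssumption P X ε σ c →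
      ∀ lam₀ lam₁ : ℝ,
        C * √(Real.log p / AdaTrans.totalSize K nT nS) ≤ lam₀ →
        C * ((nS : ℝ) / AdaTrans.totalSize K nT nS * √(Real.log p / nS)) ≤ lam₁ →
        ∃ E : Set Ω, MeasurableSet E ∧ 1 - Real.exp (-c₁ * Real.log p) ≤ P.real E ∧
          ∀ ω ∈ E,
            (AdaTrans.fusedSolutions (X ω) (AdaTrans.response (X ω) (ε ω) θ) lam₀ lam₁
              (AdaTrans.oracleWeight (AdaTrans.supp θ))).Nonempty ∧
            AdaTrans.fusedSolutions (X ω) (AdaTrans.response (X ω) (ε ω) θ) lam₀ lam₁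
                (AdaTrans.oracleWeight (AdaTrans.supp θ)) =
              AdaTrans.oracleSolutions (X ω) (AdaTrans.response (X ω) (ε ω) θ)
                (AdaTrans.supp θ) := by
  open AdaTrans in
  obtain ⟨s, hs, B, hB, hsB⟩ := exists_mgf_sq_le τ
  have hlogB : 0 ≤ Real.log B := Real.log_nonneg hB
  -- `M` and `C` are tuned so that both tails are at most a multiple of `p ^ (-(a + 5))`. The union
  -- bound costs `3 (K + 1) p ≤ p ^ (a + 4)`, which leaves `p ^ (-1)`, so `c₁ = 1`.
  set M : ℝ := (Real.log B + (a + 5) / cS) / s with hM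
  have hM0 : 0 < M := by positivity
  have hsM : s * M - Real.log B = (a + 5) / cS := by
    rw [hM]
    field_simp
    ring
  have hC2 : √(8 * c * M * (a + 5)) ^ 2 = 8 * c * M * (a + 5) := Real.sq_sqrt (by positivity)
  set C : ℝ := √(8 * c * M * (a + 5)) with hC
  have hC0 : 0 < C := by positivity
  refine ⟨C, hC0, 1, one_pos, ?_⟩
  intro K nT nS p hK hKp hnS Ω _ P _ X ε Sig σ θ hX hε lam₀ lam₁ hlam₀ hlam₁
  -- For `p < 2` the required probability is 0 and the empty event suffices.
  obtain hp | hp : p < 2 ∨ 2 ≤ p := lt_or_ge p 2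
  · have : Real.log p = 0 := by interval_cases p <;> simp
    exact ⟨∅, MeasurableSet.empty, by simp [this], by simp⟩
  have hl2 : Real.log 2 ≤ Real.log p := Real.log_le_log two_pos (by exact_mod_cast hp)
  have hl0 : 0 < Real.log p := (Real.log_pos one_lt_two).trans_le hl2
  set l : ℝ := Real.log p with hl
  have hnS0 : (0 : ℝ) < nS := (mul_pos hcS hl0).trans_le hnS
  have hN : (nS : ℝ) ≤ totalSize K nT nS := by
    have : nS ≤ totalSize K nT nS := by
      unfold totalSize
      nlinarith
    exact_mod_cast this
  have hN0 : (0 : ℝ) < totalSize K nT nS := hnS0.trans_le hN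
  have hsize (k : Fin (K + 1)) : (nS : ℝ) ≤ blockSize K nT nS k := by
    unfold blockSize
    split_ifs
    exacts [hN, le_rfl]
  -- Both penalty conditions take the same form in terms of the block size: `N` for the target
  -- block, `nS` for a contrast.
  have hlam (k : Fin (K + 1)) : C * √(blockSize K nT nS k * l) / totalSize K nT nS
      ≤ penaltyLevel lam₀ lam₁ k := by
    have key (m : ℝ) (hm : 0 < m) : √(m * l) = m * √(l / m) := by
      have h : m * l = m ^ 2 * (l / m) := by field_simp
      rw [h, Real.sqrt_mul (sq_nonneg m), Real.sqrt_sq hm.le]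
    rw [key _ (hnS0.trans_le (hsize k))]
    unfold blockSize penaltyLevel
    split_ifs
    · refine le_trans (le_of_eq ?_) hlam₀
      field_simp
    · refine le_trans (le_of_eq ?_) hlam₁
      field_simp
  -- The half compensates the factor 2 in the gradient of the squared loss.
  set t : Fin (K + 1) → ℝ := fun k => C / 2 * √(blockSize K nT nS k * l) with ht
  let bad : Fin (K + 1) × Fin p → Set Ω := fun q =>
    {ω | t q.1 ≤ |inner ℝ (stackedCol (fun r => X ω r.1 r.2) q.1 q.2)
      (oracleResidual (supp θ) (fun r => X ω r.1 r.2) fun r => ε ω r.1 r.2)|}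
  have hbad_meas (q) : MeasurableSet (bad q) :=
    measurableSet_le measurable_const ((measurable_inner_oracleResidual (supp θ) q.1 q.2).comp
      (hX.measurable_row.prodMk hε.measurable_row)).abs
  have hbad (q) : P.real (bad q) ≤ 3 * Real.exp (-(a + 5) * l) := by
    refine (measure_inner_oracleResidual_ge_le hc hX hε hs hB (fun f => hsB Ω P f) (supp θ) q.1 q.2
      hM0.le (by positivity)).trans ?_
    have hb := hsize q.1
    have hb0 := hnS0.trans_le hb
    have h1 : Real.exp (-(s * M - Real.log B) * blockSize K nT nS q.1)
        ≤ Real.exp (-(a + 5) * l) := by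
      refine Real.exp_le_exp.2 ?_
      have h2 : (a + 5) / cS * (cS * l) ≤ (a + 5) / cS * blockSize K nT nS q.1 :=
        mul_le_mul_of_nonneg_left (hnS.trans hb) (by positivity)
      have h3 : (a + 5) / cS * (cS * l) = (a + 5) * l := by field_simp
      rw [hsM]
      linarith
    have h4 : -t q.1 ^ 2 / (2 * (c * (M * blockSize K nT nS q.1))) = -(a + 5) * l := by
      simp only [ht]
      rw [mul_pow, div_pow, hC2, Real.sq_sqrt (by positivity)]
      field_simp
      ring
    rw [h4]
    linarith
  refine ⟨(⋃ q, bad q)ᶜ, (MeasurableSet.iUnion hbad_meas).compl, ?_, fun ω hω => ?_⟩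
  · rw [probReal_compl_eq_one_sub (MeasurableSet.iUnion hbad_meas)]
    refine sub_le_sub_left ((measureReal_iUnion_fintype_le _).trans
      ((Finset.sum_le_sum fun q _ => hbad q).trans ?_)) 1
    have hp0 : (0 : ℝ) < p := by positivity
    have hpe : (p : ℝ) = Real.exp l := (Real.exp_log hp0).symm
    have h2e : (2 : ℝ) ≤ Real.exp l := by rw [← hpe]; exact_mod_cast hp
    have hKe : (K : ℝ) ≤ Real.exp (a * l) := by
      rwa [← Real.log_le_iff_le_exp (by positivity)]
    have hK1 : (1 : ℝ) ≤ K := by exact_mod_cast hK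
    have h6 : ((K : ℝ) + 1) * 3 ≤ Real.exp (a * l) * Real.exp l ^ 3 := by
      have h7 : (2 : ℝ) ^ 3 ≤ Real.exp l ^ 3 := by gcongr
      have h8 : (K : ℝ) * 2 ^ 3 ≤ Real.exp (a * l) * Real.exp l ^ 3 := by gcongr
      linarith
    simp only [Finset.sum_const, Finset.card_univ, Fintype.card_prod, Fintype.card_fin, nsmul_eq_mul]
    push_cast
    calc ((K : ℝ) + 1) * p * (3 * Real.exp (-(a + 5) * l))
        = ((K + 1) * 3) * (Real.exp l * Real.exp (-(a + 5) * l)) := by rw [← hpe]; ring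
      _ ≤ Real.exp (a * l) * Real.exp l ^ 3 * (Real.exp l * Real.exp (-(a + 5) * l)) := by gcongr
      _ = Real.exp (-1 * l) := by
          rw [← Real.exp_nat_mul, ← Real.exp_add, ← Real.exp_add, ← Real.exp_add]
          congr 1
          push_cast
          ring
  · have hθ : θ ∈ oracleFeasible (supp θ) := fun k j hj => not_not.1 hj
    set x : Row K nT nS → Fin p → ℝ := fun r => X ω r.1 r.2 with hx
    refine fusedSolutions_eq_oracleSolutions _ _ _ _ _
      (oracleResidual (supp θ) x fun r => ε ω r.1 r.2)
      (Submodule.sub_starProjection_mem_orthogonal _) ?_ fun k j => ?_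
    · have hy : WithLp.toLp 2 (fun r : Row K nT nS => response (X ω) (ε ω) θ r.1 r.2)
          = fit x θ + WithLp.toLp 2 fun r : Row K nT nS => ε ω r.1 r.2 := by
        ext r
        simp [response, hx, fit_apply]
      -- What remains is the true fit plus the projected noise, both in the oracle span.
      rw [hy, oracleResidual, add_sub_assoc, sub_sub_cancel]
      exact Submodule.add_mem _ (fit_mem_oracleSpan x hθ) (Submodule.starProjection_apply_mem _ _)
    · refine lt_of_lt_of_le ?_ (hlam k)
      -- The bad events contain their boundary, so strictness comes from here although the penalty
      -- bounds are not strict.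
      have h9 : |inner ℝ (stackedCol x k j) (oracleResidual (supp θ) x fun r => ε ω r.1 r.2)|
          < t k := by
        by_contra hle
        exact hω (Set.mem_iUnion.2 ⟨(k, j), not_lt.1 hle⟩)
      calc _ < 2 / (totalSize K nT nS : ℝ) * t k := mul_lt_mul_of_pos_left h9 (by positivity)
        _ = _ := by
          simp only [ht]
          ring
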